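/- Let $a<b$ and let $w:[a,b]\to[0,\infty)$ be an integrable function with $\int_a^b w(x)\,dx>0$. Let $n\ge 1$ be an integer and let $f:[a,b]\to\mathbb R$ be $(2n-1)$-convex, that is, all divided differences satisfy $[x_1,\dots,x_{2n+1};f]\ge 0$ for any $2n+1$ distinct points $x_1,\dots,x_{2n+1}\in[a,b]$, where $[x_1;f]=f(x_1)$ and $[x_1,\dots,x_{k+1};f]=\dfrac{[x_2,\dots,x_{k+1};f]-[x_1,\dots,x_k;f]}{x_{k+1}-x_1}$. Then $fw$ is integrable on $[a,b]$ and $$\mathcal G_n(f)\le\int_a^b f(x)w(x)\,dx\le\mathcal L_{n+1}(f).$$ Here $\mathcal G_n$ and $\mathcal L_{n+1}$ are the following quadratures. Gauss quadrature: let $P_n$ be the polynomial of degree $n$ obtained by Gram--Schmidt orthogonalization of $1,x,x^2,\dots$ with respect to $\langle g,h\rangle_w=\int_a^b g(x)h(x)w(x)\,dx$. Then $$\mathcal G_n(f)=\sum_{t:\,P_n(t)=0} f(t)\int_a^b\frac{P_n(x)w(x)}{(x-t)P_n'(t)}\,dx .$$ Lobatto-type quadrature: let $Q=Q_{n-1}$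 be the polynomial of degree $n-1$ obtained in the same way from the weight $(x-a)(b-x)w(x)$. Then $$\mathcal L_{n+1}(f)=w_0f(a)+\sum_{t:\,Q(t)=0}w_tf(t)+w_nf(b),$$ where $$w_0=\frac{1}{(b-a)Q(a)^2}\int_a^b Q(x)^2(b-x)w(x)\,dx,\qquad w_n=\frac{1}{(b-a)Q(b)^2}\int_a^b Q(x)^2(x-a)w(x)\,dx,$$ $$w_t=\frac{1}{(b-t)(t-a)}\int_a^b\frac{Q(x)(x-a)(b-x)w(x)}{(x-t)Q'(t)}\,dx .$$ (It is classical that $P_n$ has $n$ distinct zeros and $Q_{n-1}$ has $n-1$ distinct zeros, all real and lying in $(a,b)$.) -/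

import Mathlib

open MeasureTheory Polynomial

noncomputable section

/-- Divided differences: `divDiff f k x` is `[x 0, …, x k; f]`, by the usual recursion. -/
def divDiff (f : ℝ → ℝ) : (k : ℕ) → (Fin (k + 1) → ℝ) → ℝ
  | 0, x => f (x 0)
  | k + 1, x =>
      (divDiff f k (fun i => x i.succ) - divDiff f k (fun i => x i.castSucc)) /
        (x (Fin.last (k + 1)) - x 0)

/-- `f` is convex of order `n` on `s`: all divided differences on `n + 2` distinct points of `s`
are nonnegative. -/
def IsNConvexOn (n : ℕ) (s : Set ℝ) (f : ℝ → ℝ) : Prop :=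
  ∀ x : Fin (n + 2) → ℝ, Function.Injective x → (∀ i, x i ∈ s) → 0 ≤ divDiff f (n + 1) x

/-- `w` is a weight function on `[a, b]`. -/
structure IsWeight (a b : ℝ) (w : ℝ → ℝ) : Prop where
  nonneg : ∀ x ∈ Set.Icc a b, 0 ≤ w x
  integrable : IntervalIntegrable w volume a b
  integral_pos : 0 < ∫ x in a..b, w x

/-- The inner product of two polynomials on `[a, b]` with respect to the weight `w`. -/
def wInner (a b : ℝ) (w : ℝ → ℝ) (p q : ℝ[X]) : ℝ :=
  ∫ x in a..b, p.eval x * q.eval x * w x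

/-- The orthogonal polynomial of degree `n` on `[a, b]` with weight `w`: the `n`-th polynomial of
the Gram-Schmidt orthogonalization of `1, X, X ^ 2, …`. -/
def orthoPoly (a b : ℝ) (w : ℝ → ℝ) (n : ℕ) : ℝ[X] :=
  X ^ n - ∑ k : Fin n,
    C (wInner a b w (X ^ n) (orthoPoly a b w k) /
        wInner a b w (orthoPoly a b w k) (orthoPoly a b w k)) * orthoPoly a b w k
termination_by n
decreasing_by all_goals exact k.2

/-- The coefficient `∫ P(x) w(x) / ((x - t) P'(t)) dx` belonging to the zero `t` of `P`. The
integrand is undefined only at the single point `x = t`, which does not affect the integral. -/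
def nodeCoeff (a b : ℝ) (w : ℝ → ℝ) (P : ℝ[X]) (t : ℝ) : ℝ :=
  ∫ x in a..b, P.eval x * w x / ((x - t) * (derivative P).eval t)

/-- The `n`-point Gauss quadrature on `[a, b]` with weight `w`. Its abscissas are the zeros of the
orthogonal polynomial of degree `n`. -/
def gaussQuad (a b : ℝ) (w : ℝ → ℝ) (n : ℕ) (f : ℝ → ℝ) : ℝ :=
  ∑ t ∈ (orthoPoly a b w n).roots.toFinset, nodeCoeff a b w (orthoPoly a b w n) t * f t

/-- The weight function `(x - a) (b - x) w(x)`. -/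
def lobattoWeight (a b : ℝ) (w : ℝ → ℝ) (x : ℝ) : ℝ := (x - a) * (b - x) * w x

/-- The polynomial of degree `m` orthogonal with respect to the weight `(x - a) (b - x) w(x)`. -/
def lobattoPoly (a b : ℝ) (w : ℝ → ℝ) (m : ℕ) : ℝ[X] := orthoPoly a b (lobattoWeight a b w) m

/-- The `(n + 1)`-point Lobatto-type quadrature on `[a, b]` with weight `w`, for `n ≥ 1`. Its
abscissas are `a`, `b` and the zeros of `Q = lobattoPoly a b w (n - 1)`. -/
def lobattoQuad (a b : ℝ) (w : ℝ → ℝ) (n : ℕ) (f : ℝ → ℝ) : ℝ :=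
  let Q := lobattoPoly a b w (n - 1)
  (1 / ((b - a) * Q.eval a ^ 2) * ∫ x in a..b, Q.eval x ^ 2 * (b - x) * w x) * f a
    + ∑ t ∈ Q.roots.toFinset,
        (1 / ((b - t) * (t - a)) * nodeCoeff a b (lobattoWeight a b w) Q t) * f t
    + (1 / ((b - a) * Q.eval b ^ 2) * ∫ x in a..b, Q.eval x ^ 2 * (x - a) * w x) * f b

end

/-! The classical argument interpolates `f` by a polynomial of degree below `2 * n` with every
quadrature node doubled: the quadrature integrates that polynomial exactly and sees only values of
`f`, and the error has the sign of a nodal polynomial made of squares. Doubling a node in Hermite's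
sense needs a derivative of `f`, which may not exist (for `n = 1`, `f` is merely convex). Here each
zero `t` is paired with a nearby point `t + h` and Lagrange interpolation is used. The nodal
polynomial contains the factors `(x - t) * (x - (t + h))`, which have the wrong sign only on the
short intervals `(t, t + h)` (`exists_doubled_nodes`). By `IsNConvexOn.mul_prod_nonneg` the
interpolant is therefore on the correct side of `f` off a set of small weight, and its integral is
the quadrature value of `f` for every `h`.

To let the exceptional set shrink, the interpolants must not blow up. Their degrees are bounded, so
their supremum is controlled by their weighted `L¹` norm (`exists_abs_eval_le_integral`), and the
resulting error term is absorbed in `le_integral_of_approx_minorants`. No limit of the interpolants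
is needed.

Gauss exactness comes from division by the orthogonal polynomial; Lobatto exactness reduces to Gauss
exactness for the weight `(x - a) * (b - x) * w x`. Integrability holds because `f` is trapped
between two interpolants, hence bounded and continuous inside the interval. -/

/-! ### Divided differences and the sign of the interpolation error. -/

/-- The divided difference is the top coefficient of an interpolating polynomial. -/
lemma exists_interpolant_coeff_eq_divDiff (f : ℝ → ℝ) (k : ℕ) (x : Fin (k + 1) → ℝ)
    (hx : Function.Injective x) :
    ∃ p : ℝ[X], p.degree < ((k + 1 : ℕ) : WithBot ℕ) ∧ (∀ i, p.eval (x i) = f (x i)) ∧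
      p.coeff k = divDiff f k x := by
  induction k with
  | zero =>
    refine ⟨C (f (x 0)), ?_, ?_, ?_⟩
    · exact lt_of_le_of_lt degree_C_le (by norm_num)
    · intro i
      rw [Fin.fin_one_eq_zero i, eval_C]
    · simp [divDiff]
  | succ k ih =>
    obtain ⟨p, hpd, hpe, hpc⟩ := ih (fun i => x i.succ) (hx.comp (Fin.succ_injective _))
    obtain ⟨q, hqd, hqe, hqc⟩ := ih (fun i => x i.castSucc) (hx.comp (Fin.castSucc_injective _))
    set s := x 0
    set t := x (Fin.last (k + 1))
    have hst : t - s ≠ 0 := sub_ne_zero.2 fun h => by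
      have := hx h
      simp [Fin.ext_iff] at this
    have hdeg : ∀ (r : ℝ[X]) (u : ℝ), r.degree < ((k + 1 : ℕ) : WithBot ℕ) →
        ((X - C u) * r).degree < ((k + 1 + 1 : ℕ) : WithBot ℕ) := by
      intro r u hr
      rw [degree_lt_iff_coeff_zero] at hr ⊢
      intro j hj
      obtain ⟨i, rfl⟩ := Nat.exists_eq_add_of_le' (le_of_add_le_right hj)
      rw [sub_mul, coeff_sub, coeff_X_mul, coeff_C_mul, hr i (by omega), hr (i + 1) (by omega)]
      ring
    have hco : ∀ (r : ℝ[X]) (u : ℝ), r.degree < ((k + 1 : ℕ) : WithBot ℕ) →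
        ((X - C u) * r).coeff (k + 1) = r.coeff k := by
      intro r u hr
      rw [sub_mul, coeff_sub, coeff_X_mul, coeff_C_mul, coeff_eq_zero_of_degree_lt hr]
      ring
    -- Neville's recursion: the multipliers of `p` and `q` sum to one, and each vanishes at the node
    -- its polynomial misses.
    refine ⟨C (t - s)⁻¹ * ((X - C s) * p - (X - C t) * q), ?_, ?_, ?_⟩
    · refine lt_of_le_of_lt ?_ (max_lt (hdeg p s hpd) (hdeg q t hqd))
      rw [degree_C_mul (inv_ne_zero hst)]
      exact degree_sub_le _ _
    · intro i
      have h1 : i ≠ 0 → p.eval (x i) = f (x i) := fun h => by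
        obtain ⟨j, rfl⟩ := Fin.exists_succ_eq.2 h
        exact hpe j
      have h2 : i ≠ Fin.last (k + 1) → q.eval (x i) = f (x i) := fun h => by
        obtain ⟨j, rfl⟩ := Fin.exists_castSucc_eq.2 h
        exact hqe j
      simp only [eval_mul, eval_C, eval_sub, eval_X]
      rcases eq_or_ne i 0 with rfl | hi0
      · rw [h2 (by simp [Fin.ext_iff])]
        field_simp
        ring
      rcases eq_or_ne i (Fin.last (k + 1)) with rfl | hil
      · rw [h1 hi0]
        field_simp
        ring
      · rw [h1 hi0, h2 hil]
        field_simp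
        ring
    · rw [coeff_C_mul, coeff_sub, hco p s hpd, hco q t hqd, hpc, hqc, divDiff,
        div_eq_inv_mul]

/-- The interpolation error of an `m`-convex function has the sign of the nodal polynomial. -/
lemma IsNConvexOn.mul_prod_nonneg {m : ℕ} {s : Set ℝ} {f : ℝ → ℝ} (hf : IsNConvexOn m s f)
    {S : Finset ℝ} (hS : S.card = m + 1) (hSs : ↑S ⊆ s) {x : ℝ} (hx : x ∈ s) :
    0 ≤ (f x - (Lagrange.interpolate S id f).eval x) * ∏ y ∈ S, (x - y) := by
  by_cases hxS : x ∈ S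
  · rw [Finset.prod_eq_zero hxS (sub_self x), mul_zero]
  classical
  have hcard : (insert x S).card = m + 2 := by rw [Finset.card_insert_of_notMem hxS, hS]
  let e : Fin (m + 2) ≃ (insert x S : Finset ℝ) := (Finset.equivFinOfCardEq hcard).symm
  let z : Fin (m + 2) → ℝ := fun i => e i
  have hz : Function.Injective z := Subtype.val_injective.comp e.injective
  have hzmem : ∀ i, z i ∈ insert x S := fun i => (e i).2
  have hzs : ∀ i, z i ∈ s := fun i => by
    rcases Finset.mem_insert.1 (hzmem i) with h | h
    · rwa [h]
    · exact hSs h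
  have hdd := hf z hz hzs
  obtain ⟨p, hpd, hpe, hpc⟩ := exists_interpolant_coeff_eq_divDiff f (m + 1) z hz
  rw [← hpc] at hdd
  have hpe' : ∀ y ∈ insert x S, p.eval y = f y := fun y hy => by
    have := hpe (e.symm ⟨y, hy⟩)
    simpa [z] using this
  -- Newton's form. Subtracting the top coefficient times the monic nodal polynomial lowers the
  -- degree, so agreement on `S` suffices.
  have key : p = Lagrange.interpolate S id f + C (p.coeff (m + 1)) * Lagrange.nodal S id := by
    have hin : (Lagrange.interpolate S id f).degree < ((m + 1 : ℕ) : WithBot ℕ) := by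
      rw [← hS]
      exact Lagrange.degree_interpolate_lt f (Function.injective_id.injOn)
    have hno : (Lagrange.nodal S (id : ℝ → ℝ)).degree = ((m + 1 : ℕ) : WithBot ℕ) := by
      rw [Lagrange.degree_nodal, hS]
    refine Polynomial.eq_of_degree_sub_lt_of_eval_finset_eq S ?_ ?_
    · rw [hS, degree_lt_iff_coeff_zero]
      intro j hj
      rcases hj.eq_or_lt with rfl | hj
      · have h1 : (Lagrange.nodal S (id : ℝ → ℝ)).coeff (m + 1) = 1 := by
          have := (Lagrange.nodal_monic (s := S) (v := (id : ℝ → ℝ))).coeff_natDegree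
          rwa [Lagrange.natDegree_nodal, hS] at this
        rw [coeff_sub, coeff_add, coeff_C_mul, h1, coeff_eq_zero_of_degree_lt hin]
        ring
      · have hj' : ((m + 1 : ℕ) : WithBot ℕ) < (j : WithBot ℕ) := by exact_mod_cast hj
        rw [coeff_sub, coeff_add, coeff_C_mul, coeff_eq_zero_of_degree_lt (hno.trans_lt hj'),
          coeff_eq_zero_of_degree_lt (hin.trans hj'),
          coeff_eq_zero_of_degree_lt (p := p) (hpd.trans_le (by exact_mod_cast hj))]
        ring
    · intro y hy
      have h2 := Lagrange.eval_interpolate_at_node f (s := S) (v := id)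
        Function.injective_id.injOn hy
      have h3 := Lagrange.eval_nodal_at_node (v := (id : ℝ → ℝ)) hy
      simp only [id] at h2 h3
      rw [hpe' y (Finset.mem_insert_of_mem hy), eval_add, eval_mul, h2, h3]
      ring
  have hval := congrArg (eval x) key
  rw [hpe' x (Finset.mem_insert_self _ _), eval_add, eval_mul, eval_C, Lagrange.eval_nodal] at hval
  simp only [id] at hval
  rw [hval, add_sub_cancel_left, mul_assoc]
  exact mul_nonneg hdd (mul_self_nonneg _)

/-- An `m`-convex function lies between two interpolants which differ in one node only. -/
lemma IsNConvexOn.mul_nonpos_of_mem_Icc {m : ℕ} {s : Set ℝ} {f : ℝ → ℝ}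
    (hf : IsNConvexOn m s f) {T : Finset ℝ} (hT : T.card = m) (hTs : ↑T ⊆ s) {c d : ℝ}
    (hc : c ∈ s) (hd : d ∈ s) (hcT : c ∉ T) (hdT : d ∉ T) {x : ℝ} (hx : x ∈ s)
    (hxcd : x ∈ Set.Icc c d) :
    (f x - (Lagrange.interpolate (insert c T) id f).eval x) *
      (f x - (Lagrange.interpolate (insert d T) id f).eval x) ≤ 0 := by
  have node : ∀ u, x ∈ insert u T →
      (Lagrange.interpolate (insert u T) id f).eval x = f x := fun u h =>
    Lagrange.eval_interpolate_at_node f (Function.injective_id.injOn) h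
  by_cases hxc : x ∈ insert c T
  · rw [node c hxc]; simp
  by_cases hxd : x ∈ insert d T
  · rw [node d hxd]; simp
  have sub : ∀ u ∈ s, ((insert u T : Finset ℝ) : Set ℝ) ⊆ s := fun u hu => by
    rw [Finset.coe_insert]
    exact Set.insert_subset hu hTs
  have h1 := hf.mul_prod_nonneg (S := insert c T) (by rw [Finset.card_insert_of_notMem hcT, hT])
    (sub c hc) hx
  have h2 := hf.mul_prod_nonneg (S := insert d T) (by rw [Finset.card_insert_of_notMem hdT, hT])
    (sub d hd) hx
  rw [Finset.prod_insert hcT] at h1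
  rw [Finset.prod_insert hdT] at h2
  have hP : ∏ y ∈ T, (x - y) ≠ 0 := Finset.prod_ne_zero_iff.2 fun y hy h =>
    hxc (Finset.mem_insert_of_mem (by rwa [sub_eq_zero.1 h]))
  have hxc' : 0 < x - c := sub_pos.2 (lt_of_le_of_ne hxcd.1 fun h => hxc (by simp [h]))
  have hxd' : 0 < d - x := sub_pos.2 (lt_of_le_of_ne hxcd.2 fun h => hxd (by simp [h]))
  set A := f x - (Lagrange.interpolate (insert c T) id f).eval x
  set B := f x - (Lagrange.interpolate (insert d T) id f).eval x
  set P := ∏ y ∈ T, (x - y)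
  -- Multiplying the two sign conditions turns the common nodes into a square; only `(x - c) * (x -
  -- d)`, which is negative, remains.
  have h3 : 0 ≤ (A * B) * (P ^ 2 * ((x - c) * (x - d))) := by
    have := mul_nonneg h1 h2
    linarith [this, show A * ((x - c) * P) * (B * ((x - d) * P))
      = (A * B) * (P ^ 2 * ((x - c) * (x - d))) by ring]
  have h4 : P ^ 2 * ((x - c) * (x - d)) < 0 :=
    mul_neg_of_pos_of_neg (by positivity) (mul_neg_of_pos_of_neg hxc' (by linarith))
  by_contra! h
  exact absurd h3 (not_le.2 (mul_neg_of_pos_of_neg h h4))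

/-! ### Boundedness, interior continuity and integrability of `f`. -/

lemma exists_bound_eval (p : ℝ[X]) (a b : ℝ) : ∃ M, ∀ x ∈ Set.Icc a b, |p.eval x| ≤ M := by
  obtain ⟨M, hM⟩ := isCompact_Icc.exists_bound_of_continuousOn (f := fun x => p.eval x)
    (s := Set.Icc a b) p.continuous.continuousOn
  exact ⟨M, hM⟩

lemma abs_le_max_of_mul_sub_nonpos {y p q : ℝ} (h : (y - p) * (y - q) ≤ 0) :
    |y| ≤ max |p| |q| := by
  rcases mul_nonpos_iff.1 h with ⟨h1, h2⟩ | ⟨h1, h2⟩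
  · exact abs_le_max_abs_abs (by linarith) (by linarith)
  · rw [max_comm]; exact abs_le_max_abs_abs (by linarith) (by linarith)

/-- With `a` and `b` as the exchanged nodes, two fixed polynomials trap `f` on the whole interval.
-/
lemma IsNConvexOn.exists_bound {m : ℕ} {a b : ℝ} (hab : a < b) {f : ℝ → ℝ}
    (hf : IsNConvexOn m (Set.Icc a b) f) : ∃ M, ∀ x ∈ Set.Icc a b, |f x| ≤ M := by
  obtain ⟨T, hT, hTm⟩ := (Set.Ioo_infinite hab).exists_subset_card_eq m
  have hTs : (T : Set ℝ) ⊆ Set.Icc a b := hT.trans Set.Ioo_subset_Icc_self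
  obtain ⟨M, hM⟩ := exists_bound_eval (Lagrange.interpolate (insert a T) id f) a b
  obtain ⟨N, hN⟩ := exists_bound_eval (Lagrange.interpolate (insert b T) id f) a b
  refine ⟨max M N, fun x hx => ?_⟩
  have h := hf.mul_nonpos_of_mem_Icc hTm hTs (Set.left_mem_Icc.2 hab.le)
    (Set.right_mem_Icc.2 hab.le) (fun h => (hT h).1.false) (fun h => (hT h).2.false) hx hx
  exact (abs_le_max_of_mul_sub_nonpos h).trans (max_le_max (hM x hx) (hN x hx))

/-- If `x₀` is a common node, the two trapping polynomials both take the value `f x₀` there and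
squeeze `f`. Having room for such a node requires `1 ≤ m`. -/
lemma IsNConvexOn.continuousOn_Ioo {m : ℕ} (hm : 1 ≤ m) {a b : ℝ} {f : ℝ → ℝ}
    (hf : IsNConvexOn m (Set.Icc a b) f) : ContinuousOn f (Set.Ioo a b) := by
  intro x₀ hx₀
  refine ContinuousAt.continuousWithinAt ?_
  have hab : a < b := hx₀.1.trans hx₀.2
  obtain ⟨T', hT', hTm'⟩ := ((Set.Ioo_infinite hab).sdiff (Set.finite_singleton x₀)).exists_subset_card_eq (m - 1)
  have hxT' : x₀ ∉ T' := fun h => (hT' h).2 rfl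
  have hTm : (insert x₀ T').card = m := by
    rw [Finset.card_insert_of_notMem hxT', hTm']; omega
  have hT : ((insert x₀ T' : Finset ℝ) : Set ℝ) ⊆ Set.Ioo a b := by
    rw [Finset.coe_insert]
    exact Set.insert_subset hx₀ (hT'.trans Set.sdiff_subset)
  set T := insert x₀ T'
  have hxT : x₀ ∈ T := Finset.mem_insert_self _ _
  set p := Lagrange.interpolate (insert a T) id f
  set q := Lagrange.interpolate (insert b T) id f
  have hp : p.eval x₀ = f x₀ := Lagrange.eval_interpolate_at_node f (Function.injective_id.injOn)
    (Finset.mem_insert_of_mem hxT)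
  have hq : q.eval x₀ = f x₀ := Lagrange.eval_interpolate_at_node f (Function.injective_id.injOn)
    (Finset.mem_insert_of_mem hxT)
  have hmin : Filter.Tendsto (fun x => min (p.eval x) (q.eval x)) (nhds x₀) (nhds (f x₀)) := by
    have := (p.continuous.min q.continuous).tendsto x₀
    simpa [hp, hq] using this
  have hmax : Filter.Tendsto (fun x => max (p.eval x) (q.eval x)) (nhds x₀) (nhds (f x₀)) := by
    have := (p.continuous.max q.continuous).tendsto x₀
    simpa [hp, hq] using this
  have hev : ∀ᶠ x in nhds x₀, (f x - p.eval x) * (f x - q.eval x) ≤ 0 := by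
    filter_upwards [Ioo_mem_nhds hx₀.1 hx₀.2] with x hx
    have hx' := Set.Ioo_subset_Icc_self hx
    exact hf.mul_nonpos_of_mem_Icc hTm (hT.trans Set.Ioo_subset_Icc_self)
      (Set.left_mem_Icc.2 hab.le) (Set.right_mem_Icc.2 hab.le) (fun h => (hT h).1.false)
      (fun h => (hT h).2.false) hx' hx'
  refine tendsto_of_tendsto_of_tendsto_of_le_of_le' hmin hmax ?_ ?_
  · filter_upwards [hev] with x hx
    rcases mul_nonpos_iff.1 hx with ⟨h1, h2⟩ | ⟨h1, h2⟩
    · exact (min_le_left _ _).trans (by linarith)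
    · exact (min_le_right _ _).trans (by linarith)
  · filter_upwards [hev] with x hx
    rcases mul_nonpos_iff.1 hx with ⟨h1, h2⟩ | ⟨h1, h2⟩
    · exact le_trans (by linarith) (le_max_right _ _)
    · exact le_trans (by linarith) (le_max_left _ _)

lemma IsNConvexOn.intervalIntegrable_mul {m : ℕ} (hm : 1 ≤ m) {a b : ℝ} (hab : a < b)
    {f w : ℝ → ℝ} (hf : IsNConvexOn m (Set.Icc a b) f) (hw : IntervalIntegrable w volume a b) :
    IntervalIntegrable (fun x => f x * w x) volume a b := by
  obtain ⟨M, hM⟩ := hf.exists_bound hab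
  -- The open interval is used because `f` may jump at the endpoints.
  rw [intervalIntegrable_iff_integrableOn_Ioo_of_le hab.le] at hw ⊢
  refine Integrable.bdd_mul (c := M) hw
    ((hf.continuousOn_Ioo hm).aestronglyMeasurable measurableSet_Ioo) ?_
  exact (ae_restrict_iff' measurableSet_Ioo).2
    (Filter.Eventually.of_forall fun x hx => hM x (Set.Ioo_subset_Icc_self hx))

/-! ### Orthogonal polynomials and their zeros. -/

section Weight
variable {a b : ℝ} {w : ℝ → ℝ}

lemma IntervalIntegrable.eval_mul (hw : IntervalIntegrable w volume a b) (p : ℝ[X]) :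
    IntervalIntegrable (fun x => p.eval x * w x) volume a b :=
  hw.continuousOn_mul p.continuous.continuousOn

lemma IsWeight.integral_mul_nonneg (hab : a < b) (hw : IsWeight a b w) {g : ℝ → ℝ}
    (hg : ∀ x ∈ Set.Icc a b, 0 ≤ g x) : 0 ≤ ∫ x in a..b, g x * w x :=
  intervalIntegral.integral_nonneg hab.le fun x hx => mul_nonneg (hg x hx) (hw.nonneg x hx)

/-- A polynomial which is nonnegative on `[a, b]` and not zero has a positive integral. -/
lemma IsWeight.integral_eval_pos (hab : a < b) (hw : IsWeight a b w) {p : ℝ[X]} (hp : p ≠ 0)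
    (hp0 : ∀ x ∈ Set.Icc a b, 0 ≤ p.eval x) : 0 < ∫ x in a..b, p.eval x * w x := by
  refine lt_of_le_of_ne (hw.integral_mul_nonneg hab hp0) fun h => ?_
  have hint := hw.integrable.eval_mul p
  have hae : ∀ᵐ x ∂volume.restrict (Set.Ioc a b), x ∈ Set.Icc a b :=
    (ae_restrict_iff' measurableSet_Ioc).2
      (Filter.Eventually.of_forall fun x hx => Set.Ioc_subset_Icc_self hx)
  rw [eq_comm, intervalIntegral.integral_eq_zero_iff_of_le_of_nonneg_ae hab.le
    (hae.mono fun x hx => mul_nonneg (hp0 x hx) (hw.nonneg x hx)) hint] at h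
  -- A zero integral makes the product vanish almost everywhere; off the finitely many roots this
  -- forces `w = 0`.
  have hroots : ∀ᵐ x ∂volume.restrict (Set.Ioc a b), x ∉ (p.roots.toFinset : Set ℝ) :=
    measure_eq_zero_iff_ae_notMem.1 (Measure.restrict_le_self.absolutelyContinuous
      (p.roots.toFinset.finite_toSet.measure_zero volume))
  have hw0 : ∫ x in a..b, w x = 0 := by
    rw [intervalIntegral.integral_of_le hab.le]
    refine integral_eq_zero_of_ae ?_
    filter_upwards [h, hroots] with x hx hxr
    rcases mul_eq_zero.1 hx with h0 | h0
    · exact absurd (by simpa [hp] using h0) hxr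
    · exact h0
  exact hw.integral_pos.ne' hw0

lemma wInner_self_pos (hab : a < b) (hw : IsWeight a b w) {p : ℝ[X]} (hp : p ≠ 0) :
    0 < wInner a b w p p := by
  have := hw.integral_eval_pos hab (mul_ne_zero hp hp) fun x _ => by
    rw [eval_mul]; exact mul_self_nonneg _
  simpa [wInner] using this

lemma wInner_comm (p q : ℝ[X]) : wInner a b w p q = wInner a b w q p := by
  simp only [wInner, mul_comm (eval _ p)]

lemma wInner_eq (p q : ℝ[X]) : wInner a b w p q = ∫ x in a..b, (p * q).eval x * w x := by
  simp only [wInner, eval_mul]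

/-- Integration against the weight as a linear functional. -/
lemma integral_eval_add (hw : IntervalIntegrable w volume a b) (p q : ℝ[X]) :
    ∫ x in a..b, (p + q).eval x * w x
      = (∫ x in a..b, p.eval x * w x) + ∫ x in a..b, q.eval x * w x := by
  rw [← intervalIntegral.integral_add (hw.eval_mul p) (hw.eval_mul q)]
  simp only [eval_add, add_mul]

lemma integral_eval_C_mul (c : ℝ) (p : ℝ[X]) :
    ∫ x in a..b, (C c * p).eval x * w x = c * ∫ x in a..b, p.eval x * w x := by
  rw [← intervalIntegral.integral_const_mul]
  simp only [Polynomial.eval_mul, eval_C, mul_assoc]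

lemma integral_eval_sub (hw : IntervalIntegrable w volume a b) (p q : ℝ[X]) :
    ∫ x in a..b, (p - q).eval x * w x
      = (∫ x in a..b, p.eval x * w x) - ∫ x in a..b, q.eval x * w x := by
  rw [← intervalIntegral.integral_sub (hw.eval_mul p) (hw.eval_mul q)]
  simp only [eval_sub, sub_mul]

lemma integral_eval_sum (hw : IntervalIntegrable w volume a b) {ι : Type*} (s : Finset ι)
    (p : ι → ℝ[X]) : ∫ x in a..b, (∑ i ∈ s, p i).eval x * w x
      = ∑ i ∈ s, ∫ x in a..b, (p i).eval x * w x := by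
  rw [← intervalIntegral.integral_finsetSum fun i _ => hw.eval_mul (p i)]
  simp only [eval_finsetSum, Finset.sum_mul]

lemma orthoPoly_sub_X_pow_degree_lt (a b : ℝ) (w : ℝ → ℝ) (n : ℕ) :
    (orthoPoly a b w n - X ^ n).degree < (n : WithBot ℕ) := by
  induction n using Nat.strong_induction_on with
  | _ n ih =>
    have hdeg : ∀ k < n, (orthoPoly a b w k).degree < (n : WithBot ℕ) := fun k hk => by
      have : orthoPoly a b w k = (orthoPoly a b w k - X ^ k) + X ^ k := by ring
      rw [this]
      refine lt_of_le_of_lt (degree_add_le _ _) (max_lt ((ih k hk).trans ?_) ?_)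
      · exact_mod_cast hk
      · rw [degree_X_pow]; exact_mod_cast hk
    rw [orthoPoly, sub_sub_cancel_left, degree_neg]
    refine lt_of_le_of_lt (degree_sum_le _ _) ?_
    refine (Finset.sup_lt_iff (WithBot.bot_lt_coe n)).2 fun k _ => ?_
    rw [← smul_eq_C_mul]
    exact (degree_smul_le _ _).trans_lt (hdeg k k.2)

lemma orthoPoly_monic (a b : ℝ) (w : ℝ → ℝ) (n : ℕ) : (orthoPoly a b w n).Monic := by
  have := monic_X_pow_add (orthoPoly_sub_X_pow_degree_lt a b w n)
  rwa [add_sub_cancel] at this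

lemma orthoPoly_degree (a b : ℝ) (w : ℝ → ℝ) (n : ℕ) : (orthoPoly a b w n).degree = n := by
  have := degree_add_eq_left_of_degree_lt
    ((orthoPoly_sub_X_pow_degree_lt a b w n).trans_eq (degree_X_pow (R := ℝ) n).symm)
  rwa [add_sub_cancel, degree_X_pow] at this

/-- A polynomial of degree less than `n` is a combination of the orthogonal polynomials. -/
lemma exists_eq_sum_orthoPoly (a b : ℝ) (w : ℝ → ℝ) (n : ℕ) (p : ℝ[X])
    (hp : p.degree < (n : WithBot ℕ)) :
    ∃ c : ℕ → ℝ, p = ∑ k ∈ Finset.range n, C (c k) * orthoPoly a b w k := by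
  induction n generalizing p with
  | zero =>
    refine ⟨0, ?_⟩
    have : p = 0 := by
      rw [← degree_eq_bot, ← Nat.WithBot.lt_zero_iff]
      simpa using hp
    simp [this]
  | succ n ih =>
    obtain ⟨c, hc⟩ := ih (p - C (p.coeff n) * orthoPoly a b w n) (by
      rw [degree_lt_iff_coeff_zero] at hp ⊢
      intro j hj
      rcases hj.eq_or_lt with rfl | hj
      · have h1 := (orthoPoly_monic a b w n).coeff_natDegree
        rw [natDegree_eq_of_degree_eq_some (orthoPoly_degree a b w n)] at h1
        rw [coeff_sub, coeff_C_mul, h1]; ring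
      · rw [coeff_sub, coeff_C_mul, hp j hj, coeff_eq_zero_of_degree_lt (p := orthoPoly a b w n)
          (by rw [orthoPoly_degree]; exact_mod_cast hj)]
        ring)
    refine ⟨Function.update c n (p.coeff n), ?_⟩
    rw [Finset.sum_range_succ, Function.update_self]
    rw [Finset.sum_congr rfl fun k hk => by
      rw [Function.update_of_ne (Finset.mem_range.1 hk).ne]]
    rw [← hc]; ring

lemma wInner_orthoPoly_of_lt (hab : a < b) (hw : IsWeight a b w) (n : ℕ) :
    ∀ k < n, wInner a b w (orthoPoly a b w n) (orthoPoly a b w k) = 0 := by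
  induction n using Nat.strong_induction_on with
  | _ n ih =>
    intro k hk
    have hne : wInner a b w (orthoPoly a b w k) (orthoPoly a b w k) ≠ 0 :=
      (wInner_self_pos hab hw (orthoPoly_monic a b w k).ne_zero).ne'
    rw [wInner_eq, orthoPoly, sub_mul, integral_eval_sub hw.integrable, Finset.sum_mul,
      integral_eval_sum hw.integrable, sub_eq_zero]
    simp only [mul_assoc, integral_eval_C_mul, ← wInner_eq]
    rw [Finset.sum_eq_single (⟨k, hk⟩ : Fin n)]
    · exact (div_mul_cancel₀ _ hne).symm
    · intro j _ hjk
      rcases lt_trichotomy (j : ℕ) k with h | h | h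
      · rw [wInner_comm (orthoPoly a b w j) (orthoPoly a b w k), ih k hk j h, mul_zero]
      · exact absurd (Fin.ext h) hjk
      · rw [ih j j.2 k h, mul_zero]
    · simp

lemma integral_orthoPoly_mul (hab : a < b) (hw : IsWeight a b w) {n : ℕ} {p : ℝ[X]}
    (hp : p.degree < (n : WithBot ℕ)) :
    ∫ x in a..b, (orthoPoly a b w n * p).eval x * w x = 0 := by
  obtain ⟨c, rfl⟩ := exists_eq_sum_orthoPoly a b w n p hp
  rw [Finset.mul_sum, integral_eval_sum hw.integrable]
  refine Finset.sum_eq_zero fun k hk => ?_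
  rw [mul_left_comm, integral_eval_C_mul, ← wInner_eq,
    wInner_orthoPoly_of_lt hab hw n k (Finset.mem_range.1 hk), mul_zero]

/-- A nonconstant divisor of the orthogonal polynomial changes its sign on `[a, b]`. -/
lemma exists_eval_neg_of_dvd_orthoPoly (hab : a < b) (hw : IsWeight a b w) {n : ℕ} {g : ℝ[X]}
    (hg : g ∣ orthoPoly a b w n) (hg0 : 0 < g.natDegree) : ∃ x ∈ Set.Icc a b, g.eval x < 0 := by
  by_contra! hpos
  obtain ⟨r, hr⟩ := hg
  have hP := (orthoPoly_monic a b w n).ne_zero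
  have hr0 : r ≠ 0 := fun h => hP (by rw [hr, h, mul_zero])
  have hgz : g ≠ 0 := fun h => hP (by rw [hr, h, zero_mul])
  have hdeg : r.degree < (n : WithBot ℕ) := by
    have h1 := natDegree_mul hgz hr0
    rw [← hr, natDegree_eq_of_degree_eq_some (orthoPoly_degree a b w n)] at h1
    rw [degree_eq_natDegree hr0]
    exact_mod_cast (by omega : r.natDegree < n)
  -- The cofactor `r` has degree below `n`, so `g * r` is orthogonal to `r`; but `g * r * r` would
  -- be nonnegative and nonzero.
  have h1 := integral_orthoPoly_mul hab hw hdeg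
  rw [hr, mul_assoc] at h1
  refine (hw.integral_eval_pos hab (mul_ne_zero hgz (mul_ne_zero hr0 hr0)) ?_).ne' h1
  intro x hx
  rw [eval_mul, eval_mul]
  exact mul_nonneg (hpos x hx) (mul_self_nonneg _)

/-- Both `X - C t` and its negative divide the orthogonal polynomial, so each is negative somewhere
on the interval. -/
lemma orthoPoly_root_mem_Ioo (hab : a < b) (hw : IsWeight a b w) {n : ℕ} {t : ℝ}
    (ht : (orthoPoly a b w n).IsRoot t) : t ∈ Set.Ioo a b := by
  have hdvd := dvd_iff_isRoot.2 ht
  constructor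
  · obtain ⟨x, hx, h⟩ := exists_eval_neg_of_dvd_orthoPoly hab hw hdvd (by simp)
    by_contra! hta
    simp only [eval_sub, eval_X, eval_C] at h
    linarith [hx.1]
  · obtain ⟨x, hx, h⟩ := exists_eval_neg_of_dvd_orthoPoly hab hw (neg_dvd.2 hdvd)
      (by rw [natDegree_neg]; simp)
    by_contra! hta
    simp only [eval_neg, eval_sub, eval_X, eval_C] at h
    linarith [hx.2]

/-- A multiple zero would give the divisor `(X - C t) ^ 2`, which is never negative. -/
lemma orthoPoly_roots_nodup (hab : a < b) (hw : IsWeight a b w) (n : ℕ) :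
    (orthoPoly a b w n).roots.Nodup := by
  rw [Multiset.nodup_iff_count_le_one]
  intro t
  rw [count_roots]
  by_contra! h
  have hdvd := (le_rootMultiplicity_iff (orthoPoly_monic a b w n).ne_zero).1 h
  obtain ⟨x, -, hx⟩ := exists_eval_neg_of_dvd_orthoPoly hab hw hdvd (by simp)
  rw [eval_pow] at hx
  exact absurd (even_two.pow_nonneg _) (not_le.2 hx)

lemma continuous_nonneg_or_nonpos_of_ne_zero {g : ℝ → ℝ} (hg : Continuous g)
    (h0 : ∀ x, g x ≠ 0) : (∀ x, 0 ≤ g x) ∨ ∀ x, g x ≤ 0 := by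
  by_contra! h
  obtain ⟨⟨x, hx⟩, ⟨y, hy⟩⟩ := h
  obtain ⟨z, hz⟩ := mem_range_of_exists_le_of_exists_ge hg ⟨x, hx.le⟩ ⟨y, hy.le⟩
  exact h0 z hz

/-- The cofactor left after splitting off all real roots has constant sign, so up to sign it is a
divisor that is never negative, hence constant. -/
lemma orthoPoly_card_roots (hab : a < b) (hw : IsWeight a b w) (n : ℕ) :
    (orthoPoly a b w n).roots.toFinset.card = n := by
  rw [Multiset.toFinset_card_of_nodup (orthoPoly_roots_nodup hab hw n)]
  obtain ⟨q, hq, hdeg, hroots⟩ := exists_prod_multiset_X_sub_C_mul (orthoPoly a b w n)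
  rw [natDegree_eq_of_degree_eq_some (orthoPoly_degree a b w n)] at hdeg
  have hq0 : q ≠ 0 := fun h => (orthoPoly_monic a b w n).ne_zero (by rw [← hq, h, mul_zero])
  have hdvd : q ∣ orthoPoly a b w n := ⟨_, by rw [mul_comm]; exact hq.symm⟩
  have hnz : ∀ x, q.eval x ≠ 0 := fun x hx => by
    have : x ∈ q.roots := (mem_roots hq0).2 hx
    simp [hroots] at this
  have hnat : q.natDegree = 0 := by
    by_contra hne
    rcases continuous_nonneg_or_nonpos_of_ne_zero q.continuous hnz with h | h
    · obtain ⟨x, -, hx⟩ := exists_eval_neg_of_dvd_orthoPoly hab hw hdvd (Nat.pos_of_ne_zero hne)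
      exact absurd (h x) (not_le.2 hx)
    · obtain ⟨x, -, hx⟩ := exists_eval_neg_of_dvd_orthoPoly hab hw (neg_dvd.2 hdvd)
        (by rw [natDegree_neg]; exact Nat.pos_of_ne_zero hne)
      rw [eval_neg] at hx
      linarith [h x]
  omega

lemma orthoPoly_eq_nodal (hab : a < b) (hw : IsWeight a b w) (n : ℕ) :
    orthoPoly a b w n = Lagrange.nodal (orthoPoly a b w n).roots.toFinset id := by
  set S := (orthoPoly a b w n).roots.toFinset with hS
  have hSc : S.card = n := orthoPoly_card_roots hab hw n
  refine Polynomial.eq_of_degree_le_of_eval_finset_eq S ?_ ?_ ?_ ?_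
  · rw [orthoPoly_degree, hSc]
  · rw [orthoPoly_degree, Lagrange.degree_nodal, hSc]
  · rw [orthoPoly_monic, Lagrange.nodal_monic]
  · intro t ht
    have h1 := Lagrange.eval_nodal_at_node (v := (id : ℝ → ℝ)) ht
    rw [id] at h1
    rw [h1]
    exact (mem_roots'.1 (Multiset.mem_toFinset.1 ht)).2

/-- Away from `x = t` the quotient in the coefficient is the Lagrange basis polynomial of the zeros.
-/
lemma nodeCoeff_eq_integral_basis (hab : a < b) (hw : IsWeight a b w) {n : ℕ} {t : ℝ}
    (ht : t ∈ (orthoPoly a b w n).roots.toFinset) :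
    nodeCoeff a b w (orthoPoly a b w n) t
      = ∫ x in a..b, (Lagrange.basis (orthoPoly a b w n).roots.toFinset id t).eval x * w x := by
  set S := (orthoPoly a b w n).roots.toFinset with hS
  rw [nodeCoeff, orthoPoly_eq_nodal hab hw n, ← hS]
  refine intervalIntegral.integral_congr_ae ?_
  have hne : ∀ᵐ x : ℝ, x ≠ t := by
    rw [ae_iff]; simp
  filter_upwards [hne] with x hx _
  have h1 := Lagrange.eval_basis_not_at_node (v := (id : ℝ → ℝ)) ht hx
  have h2 := Lagrange.nodalWeight_eq_eval_derivative_nodal (v := (id : ℝ → ℝ)) ht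
  rw [h1, h2]
  simp only [id]
  rw [div_eq_mul_inv, mul_inv]
  ring

/-! ### Exactness of the two quadratures. -/

/-- The Gauss quadrature is exact for polynomials of degree less than `2 n`. -/
lemma gaussQuad_eval (hab : a < b) (hw : IsWeight a b w) {n : ℕ} {p : ℝ[X]}
    (hp : p.degree < ((2 * n : ℕ) : WithBot ℕ)) :
    gaussQuad a b w n (fun x => p.eval x) = ∫ x in a..b, p.eval x * w x := by
  set P := orthoPoly a b w n with hP
  have hmon : P.Monic := orthoPoly_monic a b w n
  have hPd : P.degree = n := orthoPoly_degree a b w n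
  -- Orthogonality kills the quotient part of the integral, and the remainder is the interpolant of
  -- `p` at the zeros.
  set r := p %ₘ P with hr
  have hrd : r.degree < (n : WithBot ℕ) := hPd ▸ degree_modByMonic_lt p hmon
  have hq : (p /ₘ P).degree < (n : WithBot ℕ) := by
    rcases eq_or_ne (p /ₘ P) 0 with h0 | h0
    · rw [h0, degree_zero]; exact WithBot.bot_lt_coe _
    have hp0 : p ≠ 0 := fun h => h0 (by rw [h, zero_divByMonic])
    have h1 := (natDegree_lt_iff_degree_lt hp0).2 hp
    refine (natDegree_lt_iff_degree_lt h0).1 ?_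
    rcases Nat.eq_zero_or_pos n with rfl | hn
    · omega
    rw [natDegree_divByMonic p hmon, natDegree_eq_of_degree_eq_some hPd]
    omega
  have hpe : p = r + P * (p /ₘ P) := (modByMonic_add_div p P).symm
  have hint : ∫ x in a..b, p.eval x * w x = ∫ x in a..b, r.eval x * w x := by
    conv_lhs => rw [hpe]
    rw [integral_eval_add hw.integrable, integral_orthoPoly_mul hab hw hq, add_zero]
  have hSc : P.roots.toFinset.card = n := orthoPoly_card_roots hab hw n
  have hri : r = Lagrange.interpolate P.roots.toFinset id (fun x => p.eval x) := by
    refine Lagrange.eq_interpolate_of_eval_eq _ Function.injective_id.injOn (by rwa [hSc]) ?_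
    intro t ht
    have h0 : P.eval t = 0 := (mem_roots'.1 (Multiset.mem_toFinset.1 ht)).2
    conv_rhs => rw [hpe]
    simp [h0]
  rw [hint, hri, Lagrange.interpolate_apply, integral_eval_sum hw.integrable, gaussQuad]
  refine Finset.sum_congr rfl fun t ht => ?_
  rw [integral_eval_C_mul, nodeCoeff_eq_integral_basis hab hw ht, mul_comm]

lemma isWeight_lobattoWeight (hab : a < b) (hw : IsWeight a b w) :
    IsWeight a b (lobattoWeight a b w) := by
  have hfun : lobattoWeight a b w = fun x => ((X - C a) * (C b - X) : ℝ[X]).eval x * w x := by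
    funext x; simp [lobattoWeight]
  have hnn : ∀ x ∈ Set.Icc a b, 0 ≤ ((X - C a) * (C b - X) : ℝ[X]).eval x := fun x hx => by
    simpa using mul_nonneg (sub_nonneg.2 hx.1) (sub_nonneg.2 hx.2)
  have hne : ((X - C a) * (C b - X) : ℝ[X]) ≠ 0 := fun h => by
    have := congrArg (eval ((a + b) / 2)) h
    simp only [Polynomial.eval_mul, eval_sub, eval_X, eval_C, eval_zero, mul_eq_zero] at this
    rcases this with h | h <;> linarith
  rw [hfun]
  exact ⟨fun x hx => mul_nonneg (hnn x hx) (hw.nonneg x hx), hw.integrable.eval_mul _,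
    hw.integral_eval_pos hab hne hnn⟩

lemma lobattoPoly_eval_ne_zero (hab : a < b) (hw : IsWeight a b w) (m : ℕ) {x : ℝ}
    (hx : x ∉ Set.Ioo a b) : (lobattoPoly a b w m).eval x ≠ 0 := fun h =>
  hx (orthoPoly_root_mem_Ioo hab (isWeight_lobattoWeight hab hw) h)

/-- The Lobatto quadrature is exact for polynomials of degree less than `2 n`. -/
lemma lobattoQuad_eval (hab : a < b) (hw : IsWeight a b w) {n : ℕ} (hn : 1 ≤ n) {p : ℝ[X]}
    (hp : p.degree < ((2 * n : ℕ) : WithBot ℕ)) :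
    lobattoQuad a b w n (fun x => p.eval x) = ∫ x in a..b, p.eval x * w x := by
  obtain ⟨m, rfl⟩ := Nat.exists_eq_add_of_le' hn
  rw [lobattoQuad, Nat.add_sub_cancel]
  have hwl := isWeight_lobattoWeight hab hw
  set Q := lobattoPoly a b w m with hQ
  have hQd : Q.natDegree = m := natDegree_eq_of_degree_eq_some (orthoPoly_degree _ _ _ m)
  have hQa : Q.eval a ≠ 0 := lobattoPoly_eval_ne_zero hab hw m (by simp)
  have hQb : Q.eval b ≠ 0 := lobattoPoly_eval_ne_zero hab hw m (by simp)
  have hba : b - a ≠ 0 := (sub_pos.2 hab).ne'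
  set A := p.eval a / ((b - a) * Q.eval a ^ 2) with hA
  set B := p.eval b / ((b - a) * Q.eval b ^ 2) with hB
  -- The subtracted terms match `p` at `a` and `b`, vanish at the zeros of `Q`, and integrate to the
  -- two endpoint terms. Dividing `d` by `(X - C a) * (C b - X)` leaves an `r` to which Gauss
  -- exactness for the Lobatto weight applies.
  set d : ℝ[X] := p - C A * (Q ^ 2 * (C b - X)) - C B * (Q ^ 2 * (X - C a)) with hd
  have hda : d.IsRoot a := by
    simp only [hd, hA, IsRoot, eval_sub, Polynomial.eval_mul, eval_C, eval_pow, eval_X]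
    field_simp; ring
  have hdb : d.IsRoot b := by
    simp only [hd, hB, IsRoot, eval_sub, Polynomial.eval_mul, eval_C, eval_pow, eval_X]
    field_simp; ring
  have hdd : d.natDegree ≤ 2 * m + 1 := by
    have h1 : p.natDegree ≤ 2 * m + 1 := by
      refine natDegree_le_iff_coeff_eq_zero.2 fun j hj => ?_
      exact coeff_eq_zero_of_degree_lt (hp.trans_le (by exact_mod_cast (by omega)))
    have h2 : ∀ (c : ℝ) (l : ℝ[X]), l.natDegree ≤ 1 → (C c * (Q ^ 2 * l)).natDegree ≤ 2 * m + 1 := by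
      intro c l hl
      refine (natDegree_C_mul_le _ _).trans (natDegree_mul_le.trans ?_)
      rw [natDegree_pow, hQd]
      omega
    have h3 := h2 A (C b - X) (by compute_degree)
    have h4 := h2 B (X - C a) (by compute_degree)
    exact (natDegree_sub_le _ _).trans (max_le ((natDegree_sub_le _ _).trans (max_le h1 h3)) h4)
  have hdvd : (X - C a) * (C b - X) ∣ d := by
    have hco : IsCoprime (X - C a) (X - C b) := isCoprime_X_sub_C_of_isUnit_sub
      (by rw [isUnit_iff_ne_zero]; exact (sub_neg.2 hab).ne)
    have := hco.mul_dvd (dvd_iff_isRoot.2 hda) (dvd_iff_isRoot.2 hdb)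
    rw [← neg_sub X (C b), mul_neg, neg_dvd]
    exact this
  obtain ⟨r, hr⟩ := hdvd
  have hrdeg : r.degree < ((2 * m : ℕ) : WithBot ℕ) := by
    rcases eq_or_ne r 0 with h0 | h0
    · rw [h0, degree_zero]; exact WithBot.bot_lt_coe _
    have h1 : ((X - C a) * (C b - X) : ℝ[X]).natDegree = 2 := by
      have e : ((X - C a) * (C b - X) : ℝ[X]) = -((X - C a) * (X - C b)) := by ring
      rw [e, natDegree_neg, natDegree_mul (X_sub_C_ne_zero a) (X_sub_C_ne_zero b),
        natDegree_X_sub_C, natDegree_X_sub_C]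
    have h2 := natDegree_mul (ne_zero_of_natDegree_gt (n := 1) (by omega)) h0
      (p := ((X - C a) * (C b - X) : ℝ[X]))
    rw [← hr, h1] at h2
    rw [degree_eq_natDegree h0]
    exact_mod_cast (by omega : r.natDegree < 2 * m)
  have hg := gaussQuad_eval hab hwl hrdeg
  have hpe : p = (X - C a) * (C b - X) * r + C A * (Q ^ 2 * (C b - X))
      + C B * (Q ^ 2 * (X - C a)) := by
    rw [← hr, hd]; ring
  have hint : ∫ x in a..b, p.eval x * w x
      = gaussQuad a b (lobattoWeight a b w) m (fun x => r.eval x)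
        + A * (∫ x in a..b, Q.eval x ^ 2 * (b - x) * w x)
        + B * ∫ x in a..b, Q.eval x ^ 2 * (x - a) * w x := by
    conv_lhs => rw [hpe]
    rw [integral_eval_add hw.integrable, integral_eval_add hw.integrable, integral_eval_C_mul,
      integral_eval_C_mul, hg]
    congr 1
    · congr 1
      · refine intervalIntegral.integral_congr fun x _ => ?_
        simp only [lobattoWeight, Polynomial.eval_mul, eval_sub, eval_X, eval_C]
        ring
      · simp only [Polynomial.eval_mul, eval_sub, eval_X, eval_C, eval_pow]
    · simp only [Polynomial.eval_mul, eval_sub, eval_X, eval_C, eval_pow]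
  have hsum : ∑ t ∈ Q.roots.toFinset,
      1 / ((b - t) * (t - a)) * nodeCoeff a b (lobattoWeight a b w) Q t * p.eval t
      = ∑ t ∈ Q.roots.toFinset, nodeCoeff a b (lobattoWeight a b w) Q t * r.eval t := by
    refine Finset.sum_congr rfl fun t ht => ?_
    have h0 : Q.IsRoot t := (mem_roots'.1 (Multiset.mem_toFinset.1 ht)).2
    have hmem := orthoPoly_root_mem_Ioo hab hwl h0
    have h1 : b - t ≠ 0 := (sub_pos.2 hmem.2).ne'
    have h2 : t - a ≠ 0 := (sub_pos.2 hmem.1).ne'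
    have h3 : p.eval t = (t - a) * (b - t) * r.eval t := by
      conv_lhs => rw [hpe]
      simp [IsRoot.def.1 h0]
    rw [h3]
    field_simp
  have hgq : gaussQuad a b (lobattoWeight a b w) m (fun x => r.eval x)
      = ∑ t ∈ Q.roots.toFinset, nodeCoeff a b (lobattoWeight a b w) Q t * r.eval t := rfl
  rw [hint, hgq, ← hsum, hA, hB]
  simp only [div_eq_mul_inv, one_mul]
  generalize (∫ x in a..b, Q.eval x ^ 2 * (b - x) * w x) = I
  generalize (∫ x in a..b, Q.eval x ^ 2 * (x - a) * w x) = J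
  ring

end Weight

/-! ### From interpolants to `f`. -/

section Comparison
variable {a b : ℝ} {w : ℝ → ℝ}

/-- On polynomials of bounded degree the supremum norm is controlled by the weighted `L¹` norm. -/
lemma exists_abs_eval_le_integral (hab : a < b) (hw : IsWeight a b w) (N : ℕ) :
    ∃ K, 0 ≤ K ∧ ∀ p : ℝ[X], p.degree < (N : WithBot ℕ) → ∀ x ∈ Set.Icc a b,
      |p.eval x| ≤ K * ∫ x in a..b, |p.eval x| * w x := by
  choose B hB using fun k => exists_bound_eval (orthoPoly a b w k) a b
  have hB0 : ∀ k, 0 ≤ B k := fun k => (abs_nonneg _).trans (hB k a (Set.left_mem_Icc.2 hab.le))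
  have hN0 : ∀ k, 0 < wInner a b w (orthoPoly a b w k) (orthoPoly a b w k) := fun k =>
    wInner_self_pos hab hw (orthoPoly_monic a b w k).ne_zero
  -- Each coefficient in the orthogonal expansion is an inner product divided by a squared norm; one
  -- factor `B k` bounds that inner product, the other bounds the value at `x`.
  refine ⟨∑ k ∈ Finset.range N, B k * B k / wInner a b w (orthoPoly a b w k) (orthoPoly a b w k),
    Finset.sum_nonneg fun k _ => div_nonneg (mul_self_nonneg _) (hN0 k).le, fun p hp x hx => ?_⟩
  obtain ⟨c, hc⟩ := exists_eq_sum_orthoPoly a b w N p hp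
  set J := ∫ x in a..b, |p.eval x| * w x with hJ
  have hcoef : ∀ k ∈ Finset.range N,
      |c k| * wInner a b w (orthoPoly a b w k) (orthoPoly a b w k) ≤ B k * J := by
    intro k hk
    have h1 : wInner a b w (orthoPoly a b w k) p
        = c k * wInner a b w (orthoPoly a b w k) (orthoPoly a b w k) := by
      rw [wInner_eq]
      conv_lhs => rw [hc]
      rw [Finset.mul_sum, integral_eval_sum hw.integrable, Finset.sum_eq_single k]
      · rw [mul_left_comm, integral_eval_C_mul, ← wInner_eq]
      · intro j _ hjk
        rw [mul_left_comm, integral_eval_C_mul, ← wInner_eq]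
        rcases lt_or_gt_of_ne hjk with h | h
        · rw [wInner_orthoPoly_of_lt hab hw k j h, mul_zero]
        · rw [wInner_comm, wInner_orthoPoly_of_lt hab hw j k h, mul_zero]
      · exact fun h => absurd hk h
    rw [← abs_of_pos (hN0 k), ← abs_mul, ← h1, wInner, hJ, ← intervalIntegral.integral_const_mul]
    refine (intervalIntegral.abs_integral_le_integral_abs hab.le).trans ?_
    have hi : IntervalIntegrable (fun x => |p.eval x| * w x) volume a b :=
      hw.integrable.continuousOn_mul p.continuous.abs.continuousOn
    refine intervalIntegral.integral_mono_on hab.le ?_ (hi.const_mul _) fun y hy => ?_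
    · have := (hw.integrable.eval_mul (orthoPoly a b w k * p)).abs
      simpa only [Polynomial.eval_mul] using this
    · rw [abs_mul, abs_mul, abs_of_nonneg (hw.nonneg y hy), mul_assoc]
      exact mul_le_mul_of_nonneg_right (hB k y hy) (mul_nonneg (abs_nonneg _) (hw.nonneg y hy))
  conv_lhs => rw [hc]
  rw [eval_finsetSum, Finset.sum_mul]
  refine (Finset.abs_sum_le_sum_abs _ _).trans (Finset.sum_le_sum fun k hk => ?_)
  rw [Polynomial.eval_mul, eval_C, abs_mul, div_mul_eq_mul_div, le_div_iff₀ (hN0 k)]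
  calc |c k| * |(orthoPoly a b w k).eval x| * wInner a b w (orthoPoly a b w k) (orthoPoly a b w k)
      = |(orthoPoly a b w k).eval x|
        * (|c k| * wInner a b w (orthoPoly a b w k) (orthoPoly a b w k)) := by ring
    _ ≤ B k * (B k * J) := mul_le_mul (hB k x hx) (hcoef k hk)
        (mul_nonneg (abs_nonneg _) (hN0 k).le) (hB0 k)
    _ = B k * B k * J := by ring

/-- If a bounded function `f` dominates, off sets of arbitrarily small weight, polynomials of
bounded degree with integral `L`, then the integral of `f` is at least `L`. -/
lemma le_integral_of_approx_minorants (hab : a < b) (hw : IsWeight a b w) {f : ℝ → ℝ} {M : ℝ}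
    (hM : ∀ x ∈ Set.Icc a b, |f x| ≤ M)
    (hf : IntervalIntegrable (fun x => f x * w x) volume a b) (N : ℕ) (L : ℝ)
    (H : ∀ ε > 0, ∃ p : ℝ[X], ∃ I : Set ℝ, MeasurableSet I ∧ p.degree < (N : WithBot ℕ) ∧
      (∫ x in a..b, p.eval x * w x) = L ∧ (∫ x in a..b, I.indicator w x) ≤ ε ∧
      ∀ x ∈ Set.Icc a b, x ∉ I → p.eval x ≤ f x) :
    L ≤ ∫ x in a..b, f x * w x := by
  obtain ⟨K, hK0, hK⟩ := exists_abs_eval_le_integral hab hw N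
  have hM0 : 0 ≤ M := (abs_nonneg _).trans (hM a (Set.left_mem_Icc.2 hab.le))
  set C := ∫ x in a..b, |f x| * w x with hC
  have habs : ∀ g : ℝ → ℝ, IntervalIntegrable (fun x => g x * w x) volume a b →
      IntervalIntegrable (fun x => |g x| * w x) volume a b := by
    intro g hg
    refine (intervalIntegrable_congr ?_).1 hg.abs
    intro x hx
    rw [Set.uIoc_of_le hab.le] at hx
    simp only [abs_mul, abs_of_nonneg (hw.nonneg x (Set.Ioc_subset_Icc_self hx))]
  have hC0 : 0 ≤ C := hw.integral_mul_nonneg hab fun x _ => abs_nonneg _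
  -- The bound on `ε` lets the error `A`, which reappears on the right through the bound on `p`, be
  -- absorbed on the left.
  have main : ∀ ε > 0, 2 * K * ε ≤ 1 →
      L ≤ (∫ x in a..b, f x * w x) + 2 * (M + K * C) * ε := by
    intro ε hε hKε
    obtain ⟨p, I, hI, hpd, hpL, hIε, hpf⟩ := H ε hε
    have hp := hw.integrable.eval_mul p
    have he : IntervalIntegrable (fun x => (f x - p.eval x) * w x) volume a b := by
      simpa only [sub_mul] using hf.sub hp
    set A := ∫ x in a..b, |f x - p.eval x| * w x with hA
    have hA0 : 0 ≤ A := hw.integral_mul_nonneg hab fun x _ => abs_nonneg _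
    have hE : ∫ x in a..b, (f x - p.eval x) * w x = (∫ x in a..b, f x * w x) - L := by
      rw [← hpL, ← intervalIntegral.integral_sub hf hp]
      simp only [sub_mul]
    have hpA : ∫ x in a..b, |p.eval x| * w x ≤ C + A := by
      rw [hC, hA, ← intervalIntegral.integral_add (habs f hf) (habs _ he)]
      refine intervalIntegral.integral_mono_on hab.le (habs _ hp)
        ((habs f hf).add (habs _ he)) fun x hx => ?_
      rw [← add_mul]
      refine mul_le_mul_of_nonneg_right ?_ (hw.nonneg x hx)
      have := abs_sub (f x) (f x - p.eval x)
      rwa [sub_sub_cancel] at this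
    have hind : IntervalIntegrable (I.indicator w) volume a b := by
      have := hw.integrable
      rw [intervalIntegrable_iff] at this ⊢
      exact this.indicator hI
    -- Off `I` the left side is zero; on `I` it is at most twice the absolute error.
    have hpt : ∀ x ∈ Set.Icc a b, |f x - p.eval x| * w x - (f x - p.eval x) * w x
        ≤ 2 * (M + K * (C + A)) * I.indicator w x := by
      intro x hx
      by_cases hxI : x ∈ I
      · rw [Set.indicator_of_mem hxI, ← sub_mul]
        refine mul_le_mul_of_nonneg_right ?_ (hw.nonneg x hx)
        have h1 : |f x - p.eval x| ≤ M + K * (C + A) :=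
          (abs_sub _ _).trans (add_le_add (hM x hx)
            ((hK p hpd x hx).trans (mul_le_mul_of_nonneg_left hpA hK0)))
        linarith [neg_abs_le (f x - p.eval x)]
      · rw [Set.indicator_of_notMem hxI, abs_of_nonneg (sub_nonneg.2 (hpf x hx hxI))]
        simp
    have hint := intervalIntegral.integral_mono_on hab.le ((habs _ he).sub he)
      (hind.const_mul (2 * (M + K * (C + A)))) hpt
    rw [intervalIntegral.integral_sub (habs _ he) he, intervalIntegral.integral_const_mul, hE,
      ← hA] at hint
    have h2 : 2 * (M + K * (C + A)) * (∫ x in a..b, I.indicator w x)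
        ≤ 2 * (M + K * (C + A)) * ε := mul_le_mul_of_nonneg_left hIε (by positivity)
    have h3 : 2 * K * ε * A ≤ 1 * A := mul_le_mul_of_nonneg_right hKε hA0
    linarith
  refine le_of_forall_pos_le_add fun δ hδ => ?_
  set D := 2 * (M + K * C) with hD
  have hD0 : 0 ≤ D := by positivity
  obtain ⟨ε, hε, hε'⟩ : ∃ ε > 0, 2 * K * ε ≤ 1 ∧ D * ε ≤ δ := by
    refine ⟨min (1 / (2 * K + 1)) (δ / (D + 1)), by positivity, ?_, ?_⟩
    · calc 2 * K * min (1 / (2 * K + 1)) (δ / (D + 1)) ≤ 2 * K * (1 / (2 * K + 1)) := by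
            gcongr; exact min_le_left _ _
        _ ≤ 1 := by rw [mul_one_div, div_le_one (by positivity)]; linarith
    · calc D * min (1 / (2 * K + 1)) (δ / (D + 1)) ≤ D * (δ / (D + 1)) := by
            gcongr; exact min_le_right _ _
        _ ≤ δ := by
            rw [mul_div_assoc', div_le_iff₀ (by positivity)]
            nlinarith
  exact (main ε hε hε'.1).trans (by linarith [hε'.2])

/-- Doubling the nodes in `S`: there are nodes `T`, containing the base nodes `B` and the nodes in
`S`, with a nodal polynomial that has the sign of that of `B` off a set of small weight. -/
lemma exists_doubled_nodes (hab : a < b) (hw : IsWeight a b w) {S B : Finset ℝ}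
    (hS : ↑S ⊆ Set.Ioo a b) (hB : ↑B ⊆ Set.Icc a b) (hSB : Disjoint B S) {ε : ℝ} (hε : 0 < ε) :
    ∃ T : Finset ℝ, ∃ I : Set ℝ, MeasurableSet I ∧ B ⊆ T ∧ S ⊆ T ∧ ↑T ⊆ Set.Icc a b ∧
      T.card = B.card + 2 * S.card ∧ (∫ x in a..b, I.indicator w x) ≤ ε ∧
      ∀ x ∉ I, ∃ r, 0 ≤ r ∧ ∏ y ∈ T, (x - y) = (∏ y ∈ B, (x - y)) * r := by
  classical
  let I : ℝ → Set ℝ := fun h => ⋃ t ∈ S, Set.Ioo t (t + h)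
  have hImeas : ∀ h, MeasurableSet (I h) := fun h =>
    S.measurableSet_biUnion fun t _ => measurableSet_Ioo
  have hvol : Filter.Tendsto (fun h => volume.restrict (Set.Ioc a b) (I h))
      (nhdsWithin 0 (Set.Ioi 0)) (nhds 0) := by
    have h1 : ∀ h, volume.restrict (Set.Ioc a b) (I h) ≤ S.card * ENNReal.ofReal h := fun h =>
      calc volume.restrict (Set.Ioc a b) (I h) ≤ volume (I h) := Measure.restrict_apply_le _ _
        _ ≤ ∑ t ∈ S, volume (Set.Ioo t (t + h)) := measure_biUnion_finset_le _ _
        _ = S.card * ENNReal.ofReal h := by simp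
    have h2 : Filter.Tendsto (fun h : ℝ => (S.card : ENNReal) * ENNReal.ofReal h)
        (nhdsWithin 0 (Set.Ioi 0)) (nhds 0) := by
      have h3 : Filter.Tendsto ENNReal.ofReal (nhds 0) (nhds 0) := by
        simpa using ENNReal.continuous_ofReal.tendsto 0
      have := ENNReal.Tendsto.const_mul (a := (S.card : ENNReal))
        (h3.mono_left (nhdsWithin_le_nhds (s := Set.Ioi 0))) (Or.inr (ENNReal.natCast_ne_top _))
      simpa using this
    exact tendsto_of_tendsto_of_tendsto_of_le_of_le tendsto_const_nhds h2 (fun _ => zero_le) h1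
  have hwi : Integrable w (volume.restrict (Set.Ioc a b)) :=
    (intervalIntegrable_iff_integrableOn_Ioc_of_le hab.le).1 hw.integrable
  -- Absolute continuity of the integral: small measure gives small weight.
  have hsmall : ∀ᶠ h in nhdsWithin (0 : ℝ) (Set.Ioi 0),
      ∫ x in I h, w x ∂volume.restrict (Set.Ioc a b) < ε :=
    (hwi.tendsto_setIntegral_nhds_zero hvol).eventually (gt_mem_nhds hε)
  have hpos : ∀ᶠ h in nhdsWithin (0 : ℝ) (Set.Ioi 0), 0 < h := self_mem_nhdsWithin
  have hltb : ∀ᶠ h in nhdsWithin (0 : ℝ) (Set.Ioi 0), ∀ t ∈ S, t + h < b := by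
    rw [Filter.eventually_all_finset]
    intro t ht
    have : ∀ᶠ h in nhds (0 : ℝ), h < b - t := gt_mem_nhds (sub_pos.2 (hS ht).2)
    exact (this.filter_mono nhdsWithin_le_nhds).mono fun h hh => by linarith
  -- The shifted nodes must be new, or the node count would drop.
  have hne : ∀ᶠ h in nhdsWithin (0 : ℝ) (Set.Ioi 0), ∀ t ∈ S, ∀ y ∈ B ∪ S, t + h ≠ y := by
    rw [Filter.eventually_all_finset]
    intro t _
    rw [Filter.eventually_all_finset]
    intro y _
    rcases eq_or_ne y t with rfl | hyt
    · exact hpos.mono fun h hh => by linarith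
    · have : ∀ᶠ h in nhds (0 : ℝ), h ≠ y - t := isOpen_ne.mem_nhds (sub_ne_zero.2 hyt).symm
      exact (this.filter_mono nhdsWithin_le_nhds).mono fun h hh hc => hh (by linarith)
  obtain ⟨h, ⟨hsm, hp⟩, hb, hn⟩ := ((hsmall.and hpos).and (hltb.and hne)).exists
  have hinj : Function.Injective fun t : ℝ => t + h := add_left_injective h
  have hdisj : Disjoint (B ∪ S) (S.image fun t => t + h) := by
    rw [Finset.disjoint_right]
    intro y hy
    obtain ⟨t, ht, rfl⟩ := Finset.mem_image.1 hy
    exact fun hmem => hn t ht _ hmem rfl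
  refine ⟨(B ∪ S) ∪ S.image (fun t => t + h), I h, hImeas h, ?_, ?_, ?_, ?_, ?_, ?_⟩
  · exact Finset.subset_union_left.trans Finset.subset_union_left
  · exact Finset.subset_union_right.trans Finset.subset_union_left
  · intro y hy
    rcases Finset.mem_union.1 hy with hy | hy
    · rcases Finset.mem_union.1 hy with hy | hy
      · exact hB hy
      · exact Set.Ioo_subset_Icc_self (hS hy)
    · obtain ⟨t, ht, rfl⟩ := Finset.mem_image.1 hy
      exact ⟨by linarith [(hS ht).1], (hb t ht).le⟩
  · rw [Finset.card_union_of_disjoint hdisj, Finset.card_union_of_disjoint hSB,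
      Finset.card_image_of_injective _ hinj]
    ring
  · rw [intervalIntegral.integral_of_le hab.le, integral_indicator (hImeas h)]
    exact hsm.le
  · intro x hx
    refine ⟨∏ t ∈ S, (x - t) * (x - (t + h)), Finset.prod_nonneg fun t ht => ?_, ?_⟩
    · have hx' : x ∉ Set.Ioo t (t + h) := fun hmem => hx (Set.mem_biUnion ht hmem)
      rcases le_or_gt x t with h1 | h1
      · exact mul_nonneg_of_nonpos_of_nonpos (by linarith) (by linarith)
      · have h2 : t + h ≤ x := not_lt.1 fun h2 => hx' ⟨h1, h2⟩
        exact mul_nonneg (by linarith) (by linarith)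
    · rw [Finset.prod_union hdisj, Finset.prod_union hSB, Finset.prod_image hinj.injOn,
        Finset.prod_mul_distrib]
      ring

/-- The error and the nodal product share a sign, so `σ` passes from one to the other; `σ = 1`
serves Gauss and `σ = -1` Lobatto. -/
lemma IsNConvexOn.le_of_interpolate {m : ℕ} {s : Set ℝ} {f : ℝ → ℝ} (hf : IsNConvexOn m s f)
    {T : Finset ℝ} (hT : T.card = m + 1) (hTs : ↑T ⊆ s) {x : ℝ} (hx : x ∈ s)
    {σ : ℝ} (hσ : 0 ≤ σ * ∏ y ∈ T, (x - y)) :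
    0 ≤ σ * (f x - (Lagrange.interpolate T id f).eval x) := by
  by_cases hxT : x ∈ T
  · have := Lagrange.eval_interpolate_at_node f (v := id) Function.injective_id.injOn hxT
    rw [id] at this
    rw [this]; simp
  · have hP : ∏ y ∈ T, (x - y) ≠ 0 := Finset.prod_ne_zero_iff.2 fun y hy h =>
      hxT (by rwa [sub_eq_zero.1 h])
    have h1 := hf.mul_prod_nonneg hT hTs hx
    set P := ∏ y ∈ T, (x - y)
    set e := f x - (Lagrange.interpolate T id f).eval x
    have h2 : 0 ≤ (σ * e) * P ^ 2 := by
      have := mul_nonneg hσ h1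
      linarith [show σ * P * (e * P) = σ * e * P ^ 2 by ring]
    exact nonneg_of_mul_nonneg_left h2 (by positivity)

/-- There are no base nodes: the `n` doubled zeros give `2 * n` nodes and a nodal product that is
nonnegative off `I`. -/
lemma IsNConvexOn.gaussQuad_le_integral (hab : a < b) (hw : IsWeight a b w) {n : ℕ} (hn : 1 ≤ n)
    {f : ℝ → ℝ} (hf : IsNConvexOn (2 * n - 1) (Set.Icc a b) f) :
    gaussQuad a b w n f ≤ ∫ x in a..b, f x * w x := by
  obtain ⟨M, hM⟩ := hf.exists_bound hab
  refine le_integral_of_approx_minorants hab hw hM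
    (hf.intervalIntegrable_mul (by omega) hab hw.integrable) (2 * n) _ fun ε hε => ?_
  have hcard := orthoPoly_card_roots hab hw n
  obtain ⟨T, I, hI, -, hST, hTs, hTc, hIε, hsign⟩ := exists_doubled_nodes (B := ∅)
    (S := (orthoPoly a b w n).roots.toFinset) hab hw
    (fun t ht => orthoPoly_root_mem_Ioo hab hw (mem_roots'.1 (Multiset.mem_toFinset.1 ht)).2)
    (by simp) (by simp) hε
  rw [hcard, Finset.card_empty, zero_add] at hTc
  have hpd : (Lagrange.interpolate T id f).degree < ((2 * n : ℕ) : WithBot ℕ) := by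
    rw [← hTc]
    exact Lagrange.degree_interpolate_lt f Function.injective_id.injOn
  refine ⟨Lagrange.interpolate T id f, I, hI, hpd, ?_, hIε, fun x hx hxI => ?_⟩
  · rw [← gaussQuad_eval hab hw hpd, gaussQuad, gaussQuad]
    refine Finset.sum_congr rfl fun t ht => ?_
    have := Lagrange.eval_interpolate_at_node f (v := id) Function.injective_id.injOn (hST ht)
    rw [id] at this
    rw [this]
  · obtain ⟨r, hr, hprod⟩ := hsign x hxI
    have := hf.le_of_interpolate (σ := 1) (by omega) hTs hx (by rw [hprod]; simpa using hr)
    linarith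

/-- The simple nodes `a` and `b` contribute `(x - a) * (x - b) ≤ 0`, which reverses the inequality;
the minorant argument is applied to `-f`. -/
lemma IsNConvexOn.integral_le_lobattoQuad (hab : a < b) (hw : IsWeight a b w) {n : ℕ}
    (hn : 1 ≤ n) {f : ℝ → ℝ} (hf : IsNConvexOn (2 * n - 1) (Set.Icc a b) f) :
    ∫ x in a..b, f x * w x ≤ lobattoQuad a b w n f := by
  obtain ⟨M, hM⟩ := hf.exists_bound hab
  have hwl := isWeight_lobattoWeight hab hw
  have hint := hf.intervalIntegrable_mul (by omega) hab hw.integrable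
  suffices -lobattoQuad a b w n f ≤ ∫ x in a..b, (-f x) * w x by
    simp only [neg_mul, intervalIntegral.integral_neg] at this
    linarith
  refine le_integral_of_approx_minorants hab hw (M := M) (fun x hx => by rw [abs_neg]; exact hM x hx)
    (by simpa only [neg_mul] using! hint.neg) (2 * n) _ fun ε hε => ?_
  have hcard := orthoPoly_card_roots hab hwl (n - 1)
  have hSab : (((lobattoPoly a b w (n - 1)).roots.toFinset : Finset ℝ) : Set ℝ) ⊆ Set.Ioo a b :=
    fun t ht => orthoPoly_root_mem_Ioo hab hwl (mem_roots'.1 (Multiset.mem_toFinset.1 ht)).2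
  obtain ⟨T, I, hI, hBT, hST, hTs, hTc, hIε, hsign⟩ := exists_doubled_nodes (B := {a, b})
    (S := (lobattoPoly a b w (n - 1)).roots.toFinset) hab hw hSab
    (by intro x hx
        rcases (by simpa using hx : x = a ∨ x = b) with rfl | rfl
        · exact Set.left_mem_Icc.2 hab.le
        · exact Set.right_mem_Icc.2 hab.le)
    (by rw [Finset.disjoint_right]
        intro x hx hx'
        have h1 := hSab hx
        rcases (by simpa using hx' : x = a ∨ x = b) with rfl | rfl
        · exact h1.1.false
        · exact h1.2.false) hε
  rw [lobattoPoly, hcard, Finset.card_pair hab.ne] at hTc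
  -- Two endpoints and `n - 1` doubled zeros; `1 ≤ n` makes the truncated subtraction harmless.
  have hTc' : T.card = 2 * n := by omega
  have hpd : (Lagrange.interpolate T id f).degree < ((2 * n : ℕ) : WithBot ℕ) := by
    rw [← hTc']
    exact Lagrange.degree_interpolate_lt f Function.injective_id.injOn
  have hnode : ∀ t ∈ T, (Lagrange.interpolate T id f).eval t = f t := fun t ht => by
    have := Lagrange.eval_interpolate_at_node f (v := id) Function.injective_id.injOn ht
    rwa [id] at this
  refine ⟨-Lagrange.interpolate T id f, I, hI, by rwa [degree_neg], ?_, hIε, fun x hx hxI => ?_⟩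
  · simp only [eval_neg, neg_mul, intervalIntegral.integral_neg]
    rw [← lobattoQuad_eval hab hw hn hpd, lobattoQuad, lobattoQuad]
    simp only [hnode a (hBT (by simp)), hnode b (hBT (by simp))]
    rw [Finset.sum_congr rfl fun t ht => by rw [hnode t (hST ht)]]
  · obtain ⟨r, hr, hprod⟩ := hsign x hxI
    have := hf.le_of_interpolate (σ := -1) (by omega) hTs hx (by
      rw [hprod, Finset.prod_pair hab.ne]
      have := mul_nonneg (mul_nonneg (sub_nonneg.2 hx.1) (sub_nonneg.2 hx.2)) hr
      linarith [show -1 * ((x - a) * (x - b) * r) = (x - a) * (b - x) * r by ring])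
    rw [eval_neg]
    linarith

end Comparison

theorem mainTheorem3 (a b : ℝ) (hab : a < b) (w : ℝ → ℝ) (hw : IsWeight a b w)
    (n : ℕ) (hn : 1 ≤ n) (f : ℝ → ℝ) (hf : IsNConvexOn (2 * n - 1) (Set.Icc a b) f) :
    IntervalIntegrable (fun x => f x * w x) volume a b ∧
      gaussQuad a b w n f ≤ ∫ x in a..b, f x * w x ∧
      ∫ x in a..b, f x * w x ≤ lobattoQuad a b w n f :=
  ⟨hf.intervalIntegrable_mul (by omega) hab hw.integrable,
    hf.gaussQuad_le_integral hab hw hn, hf.integral_le_lobattoQuad hab hw hn⟩
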